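/- **Theorem 4.7 (dual of the Holevo bound).** Let $H$ be a finite-dimensional complex Hilbert space, let $A$ and $B$ be finite sets, and let $\{E_b\}_{b\in B}$ be a POVM on $H$, i.e. positive (semidefinite) operators on $H$ with $\sum_{b} E_b = I$. Let $\rho$ be a density operator on $H$ (a positive operator with $\mathrm{tr}[\rho]=1$), and let $\rho = \sum_{a\in A} q(a)\rho_a$, where the $\rho_a$ are density operators on $H$ and $q(a)\ge 0$, $\sum_a q(a) = 1$. Put $p(a,b) := \mathrm{tr}[E_b\rho_a]\,q(a)$, with marginals $p(a):=\sum_b p(a,b) = q(a)$ and $p(b) := \sum_a p(a,b) = \mathrm{tr}[E_b\rho]$. Let $$I^{A:B} := \sum_{a,b} p(a,b)\ln\frac{p(a,b)}{p(a)p(b)}$$ be the classical mutual information between $a$ and $b$, and let $$I_{\mathrm{QC}}^{S:B} := S(\rho) - \sum_b p(b)\, S(\rho_b),\qquad \rho_b := \frac{1}{p(b)}\sqrt{E_b}\,\rho\,\sqrt{E_b},$$ be the QC-mutual information, where $S(\rho) := -\mathrm{tr}[\rho\ln\rho]$ is the von Neumann entropy, $0\ln 0 := 0$, and terms with $p(a,b)=0$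 or $p(b)=0$ are zero. Then $$I^{A:B} \le I_{\mathrm{QC}}^{S:B}.$$ -/

import Mathlib

/-! Finite-dimensional quantum states, measurements and their entropic quantities.

Throughout, `H` is a finite-dimensional complex Hilbert space; operators on `H` are the elements of
`H →L[ℂ] H` (in finite dimension every linear operator is continuous), and functions of operators
(logarithm, square root) are taken by the continuous functional calculus. -/

noncomputable section

namespace QuantumInfo

variable {H : Type*} [NormedAddCommGroup H] [InnerProductSpace ℂ H] [FiniteDimensional ℂ H]

/-- The trace of an operator on a finite-dimensional Hilbert space. -/
def trace (X : H →L[ℂ] H) : ℂ :=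
  LinearMap.trace ℂ H (X : H →ₗ[ℂ] H)

/-- Density operators: positive operators of trace one. -/
structure IsDensityOperator (ρ : H →L[ℂ] H) : Prop where
  isPositive : ρ.IsPositive
  trace_eq_one : trace ρ = 1

/-- A positive operator-valued measure with finite outcome set `B`:
positive operators `E b` which sum to the identity. -/
structure IsPOVM {B : Type*} [Fintype B] (E : B → H →L[ℂ] H) : Prop where
  isPositive : ∀ b, (E b).IsPositive
  sum_eq_one : ∑ b, E b = 1

/-- The probability `tr[F ρ]` of the outcome with POVM element `F` in the state `ρ`. The trace
is a complex number which is real for positive `F` and `ρ`; its real part is taken. -/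
def prob (F ρ : H →L[ℂ] H) : ℝ :=
  (trace (F * ρ)).re

/-- The von Neumann entropy `S(ρ) = - tr[ρ ln ρ]`, with `0 ln 0 = 0`. -/
def entropy [CompleteSpace H] (ρ : H →L[ℂ] H) : ℝ :=
  -(trace (ρ * CFC.log ρ)).re

/-- The state `ρ_b = √F ρ √F / p` after the outcome with POVM element `F`, where `p = tr[F ρ]`.
For `p = 0` this is the zero operator (and `√F ρ √F = 0`). -/
def postState [CompleteSpace H] (F ρ : H →L[ℂ] H) : H →L[ℂ] H :=
  (prob F ρ)⁻¹ • (CFC.sqrt F * ρ * CFC.sqrt F)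

/-- The QC-mutual information (Groenewold–Ozawa information)
`S(ρ) - ∑_b p(b) S(√E_b ρ √E_b / p(b))` with `p(b) = tr[E_b ρ]`; an outcome with `p(b) = 0`
contributes zero. -/
def qcMutualInfo [CompleteSpace H] {B : Type*} [Fintype B]
    (E : B → H →L[ℂ] H) (ρ : H →L[ℂ] H) : ℝ :=
  entropy ρ - ∑ b, prob (E b) ρ * entropy (postState (E b) ρ)

/-- The mutual information `∑_{a,b} p(a,b) ln (p(a,b) / (p(a) p(b)))` of a joint distribution on a
finite product, where `p(a)` and `p(b)` are the marginals; terms with `p(a,b) = 0` are zero. -/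
def classicalMutualInfo {A B : Type*} [Fintype A] [Fintype B] (p : A → B → ℝ) : ℝ :=
  ∑ a, ∑ b, p a b * Real.log (p a b / ((∑ b', p a b') * (∑ a', p a' b)))

end QuantumInfo

end

/-! The proof is dual to the usual proof of the Holevo bound. Write `p(a,b) = tr[E_b τ_a]` with
`τ_a = q(a) σ_a`, so that `ρ = ∑_a τ_a` and `q(a) = tr τ_a`. After the terms `p(b) ln p(b)`, which
are common to both sides, are cancelled, the claim splits into one inequality per outcome
`F = E_b`:
`∑_a p_a (ln p_a - ln q_a) ≤ tr[X ln X] - tr[F ρ ln ρ]`, where `X = √F ρ √F`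
(`sum_prob_mul_log_le`); the sum over `b` of the last terms is `tr[ρ ln ρ]` because `∑_b E_b = 1`.

Each of these inequalities says that relative entropy does not increase under a measurement. The map
`m : x ↦ (√τ_a x)_a` from `H` to the Hilbert sum of copies of `H` satisfies `m⋆ m = ρ`, and the
coordinate projections of the sum form a projective measurement. For an eigenbasis `u_i` of `X`
(eigenvalues `t_i`) and an eigenbasis `e_j` of `ρ` (eigenvalues `r_j`), the families
`g_i = m (√F u_i)` and `h_j = m e_j` are orthogonal, with squared norms `t_i` and `r_j`. With
`v_ji = ⟪e_j, √F u_i⟫` the right-hand side is `∑_ij |v_ji|² r_j (ln t_i - ln r_j)`, and the two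
sides are compared through the integral representation of the logarithm: it suffices
(`sum_mul_log_sub_log_nonneg`) that for all `s > 0`
`∑_a p_a² / (q_a + s p_a) ≤ ∑_ij |v_ji|² r_j t_i / (r_j + s t_i)`.
This resolvent inequality (`sum_sq_div_le`) is a variational one: the right-hand side is a supremum
of quadratic functionals of an operator, which is tested on the diagonal operator
`Y = ∑_a p_a / (q_a + s p_a) P_a`, with `P_a` the coordinate projections, by means of Bessel's
inequality. -/

namespace QuantumInfo

/-! ### From resolvents to logarithms -/

open Filter Topology in
/-- The function `G s = ∑ c_k ln (r_k + s t_k)` has the derivative that `h` assumes to be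
nonnegative. Since `∑ c_k = 0`, its increase from `s = 0` to `s = ∞` is
`∑ c_k (ln t_k - ln r_k)`. -/
theorem sum_mul_log_sub_log_nonneg {κ : Type*} [Fintype κ] (c r t : κ → ℝ)
    (hr : ∀ k, c k ≠ 0 → 0 < r k) (ht : ∀ k, c k ≠ 0 → 0 < t k) (hc : ∑ k, c k = 0)
    (h : ∀ s : ℝ, 0 < s → 0 ≤ ∑ k, c k * (t k / (r k + s * t k))) :
    0 ≤ ∑ k, c k * (Real.log (t k) - Real.log (r k)) := by
  set G : ℝ → ℝ := fun s => ∑ k, c k * Real.log (r k + s * t k) with hG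
  have hderiv : ∀ s : ℝ, 0 ≤ s → HasDerivAt G (∑ k, c k * (t k / (r k + s * t k))) s := by
    intro s hs
    refine HasDerivAt.fun_sum fun k _ => ?_
    by_cases hk : c k = 0
    · simpa [hk] using hasDerivAt_const s (0 : ℝ)
    · have h1 : HasDerivAt (fun s : ℝ => r k + s * t k) (t k) s := by
        simpa using ((hasDerivAt_id s).mul_const (t k)).const_add (r k)
      have h2 : r k + s * t k ≠ 0 := by
        have := hr k hk
        have := ht k hk
        positivity
      exact (h1.log h2).const_mul (c k)
  have hmono : MonotoneOn G (Set.Ici 0) := by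
    refine monotoneOn_of_deriv_nonneg (convex_Ici 0)
      (fun s hs => (hderiv s hs).continuousAt.continuousWithinAt) ?_ ?_
    · intro s hs
      rw [interior_Ici] at hs
      exact (hderiv s (le_of_lt hs)).differentiableAt.differentiableWithinAt
    · intro s hs
      rw [interior_Ici] at hs
      rw [(hderiv s (le_of_lt hs)).deriv]
      exact h s hs
  have hle : ∀ ε : ℝ, 0 < ε →
      ∑ k, c k * Real.log (r k) ≤ ∑ k, c k * Real.log (ε * r k + t k) := by
    intro ε hε
    have h0 : G 0 ≤ G ε⁻¹ :=
      hmono (Set.mem_Ici.2 le_rfl) (Set.mem_Ici.2 (inv_pos.2 hε).le) (inv_pos.2 hε).le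
    -- the total weight vanishes, so a common factor inside the logarithms is immaterial
    have h1 : ∑ k, c k * Real.log (ε * r k + t k) = G ε⁻¹ + (∑ k, c k) * Real.log ε := by
      rw [hG, Finset.sum_mul, ← Finset.sum_add_distrib]
      refine Finset.sum_congr rfl fun k _ => ?_
      by_cases hk : c k = 0
      · simp [hk]
      · have := hr k hk
        have := ht k hk
        have h2 : ε * r k + t k = (r k + ε⁻¹ * t k) * ε := by field_simp
        rw [h2, Real.log_mul (by positivity) hε.ne', mul_add]
    rw [h1, hc, zero_mul, add_zero]
    simpa [hG] using h0
  have hlim : Tendsto (fun ε : ℝ => ∑ k, c k * Real.log (ε * r k + t k)) (𝓝[>] 0)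
      (𝓝 (∑ k, c k * Real.log (t k))) := by
    refine tendsto_finsetSum _ fun k _ => ?_
    by_cases hk : c k = 0
    · simp [hk]
    · have h1 : ContinuousAt (fun ε : ℝ => c k * Real.log (ε * r k + t k)) 0 := by
        refine continuousAt_const.mul (ContinuousAt.log (by fun_prop) ?_)
        simpa using (ht k hk).ne'
      have h2 := h1.tendsto
      simp only [zero_mul, zero_add] at h2
      exact h2.mono_left nhdsWithin_le_nhds
  have := ge_of_tendsto hlim (eventually_nhdsWithin_of_forall fun ε hε => hle ε hε)
  simp only [mul_sub, Finset.sum_sub_distrib]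
  linarith

/-! ### The variational inequality for orthogonal families -/

theorem eq_norm_sq_of_inner_eq_ite {K I : Type*} [NormedAddCommGroup K] [InnerProductSpace ℂ K]
    [DecidableEq I] {g : I → K} {t : I → ℝ}
    (hg : ∀ i k, inner ℂ (g i) (g k) = if i = k then (t i : ℂ) else 0) (i : I) :
    t i = ‖g i‖ ^ 2 := by
  have h := hg i i
  rw [if_pos rfl, inner_self_eq_norm_sq_to_K] at h
  exact (Complex.ofReal_injective (by rw [← h]; push_cast; rfl)).symm

/-- Bessel's inequality for an orthogonal family with squared norms `t i`. Vanishing vectors are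
allowed; they contribute zero, since `0⁻¹ = 0`. -/
theorem sum_inv_mul_norm_inner_sq_le {K I : Type*} [NormedAddCommGroup K] [InnerProductSpace ℂ K]
    [Fintype I] [DecidableEq I] (g : I → K) (t : I → ℝ)
    (hg : ∀ i k, inner ℂ (g i) (g k) = if i = k then (t i : ℂ) else 0) (x : K) :
    ∑ i, (t i)⁻¹ * ‖inner ℂ (g i) x‖ ^ 2 ≤ ‖x‖ ^ 2 := by
  have ht : ∀ i, t i = ‖g i‖ ^ 2 := eq_norm_sq_of_inner_eq_ite hg
  have hon : Orthonormal ℂ (fun i : {i // t i ≠ 0} => ((‖g i‖⁻¹ : ℝ) : ℂ) • g i) := by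
    constructor
    · rintro ⟨i, hi⟩
      have : ‖g i‖ ≠ 0 := fun h => hi (by rw [ht, h]; simp)
      simp [norm_smul, this]
    · rintro ⟨i, hi⟩ ⟨k, hk⟩ hik
      have : i ≠ k := fun h => hik (Subtype.ext h)
      simp [inner_smul_left, inner_smul_right, hg, this]
  have h := hon.sum_inner_products_le x (s := Finset.univ)
  refine le_trans (le_of_eq ?_) h
  have h3 : ∀ i : {i // t i ≠ 0}, ‖inner ℂ (((‖g i‖⁻¹ : ℝ) : ℂ) • g i) x‖ ^ 2
      = (t i)⁻¹ * ‖inner ℂ (g i) x‖ ^ 2 := by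
    rintro ⟨i, hi⟩
    rw [inner_smul_left, norm_mul, mul_pow, ht i]
    simp
  simp only [h3]
  rw [← Finset.sum_filter_of_ne (p := fun i => t i ≠ 0)]
  · exact Finset.sum_subtype _ (by simp) _
  · intro i _ hi h0
    exact hi (by simp [h0])

/-- The inequality of arithmetic and geometric means with weights `(r + s t) / (r t)` for `w` and
`r t / (r + s t)` for `v`. -/
theorem two_mul_re_mul_le {v w : ℂ} {r t s : ℝ} (hr : 0 ≤ r) (ht : 0 ≤ t) (hs : 0 < s)
    (hwr : r = 0 → w = 0) (hwt : t = 0 → w = 0) :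
    2 * (v * w).re ≤ t⁻¹ * ‖w‖ ^ 2 + s * (r⁻¹ * ‖w‖ ^ 2) + ‖v‖ ^ 2 * r * (t / (r + s * t)) := by
  by_cases hw : w = 0
  · subst hw
    simp only [mul_zero, Complex.zero_re, norm_zero]
    have : 0 ≤ ‖v‖ ^ 2 * r * (t / (r + s * t)) := by positivity
    simpa using this
  have hr' : 0 < r := lt_of_le_of_ne hr fun h => hw (hwr h.symm)
  have ht' : 0 < t := lt_of_le_of_ne ht fun h => hw (hwt h.symm)
  have h1 : (v * w).re ≤ ‖v‖ * ‖w‖ := (Complex.re_le_norm _).trans (norm_mul v w).le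
  have h2 : t⁻¹ * ‖w‖ ^ 2 + s * (r⁻¹ * ‖w‖ ^ 2) + ‖v‖ ^ 2 * r * (t / (r + s * t))
      - 2 * (‖v‖ * ‖w‖) = ((r + s * t) * ‖w‖ - ‖v‖ * (r * t)) ^ 2 / (r * t * (r + s * t)) := by
    field_simp
    ring
  have h3 : 0 ≤ ((r + s * t) * ‖w‖ - ‖v‖ * (r * t)) ^ 2 / (r * t * (r + s * t)) := by positivity
  linarith

variable {A H I J : Type*} [Fintype A] [NormedAddCommGroup H] [InnerProductSpace ℂ H]
  [Fintype I] [DecidableEq I] [Fintype J] [DecidableEq J]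

/-- The resolvent inequality: with `p_a = ∑ i, ‖g i a‖ ^ 2` and `q_a = ∑ j, ‖h j a‖ ^ 2`, the
functional `⟪ξ, (Δ + s)⁻¹ ξ⟫` of the relative modular operator does not increase under the
measurement of the coordinate `a`. Here `hv` states that the `g i` lie in the span of the `h j`. -/
theorem sum_sq_div_le
    (g : I → PiLp 2 (fun _ : A => H)) (h : J → PiLp 2 (fun _ : A => H))
    (t : I → ℝ) (r : J → ℝ) (v : J → I → ℂ)
    (hg : ∀ i k, inner ℂ (g i) (g k) = if i = k then (t i : ℂ) else 0)
    (hh : ∀ j l, inner ℂ (h j) (h l) = if j = l then (r j : ℂ) else 0)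
    (hv : ∀ i, g i = ∑ j, v j i • h j) {s : ℝ} (hs : 0 < s) :
    ∑ a, (∑ i, ‖g i a‖ ^ 2) * ((∑ i, ‖g i a‖ ^ 2) /
        ((∑ j, ‖h j a‖ ^ 2) + s * ∑ i, ‖g i a‖ ^ 2)) ≤
      ∑ i, ∑ j, ‖v j i‖ ^ 2 * r j * (t i / (r j + s * t i)) := by
  set p : A → ℝ := fun a => ∑ i, ‖g i a‖ ^ 2 with hp
  set q : A → ℝ := fun a => ∑ j, ‖h j a‖ ^ 2 with hq
  set y : A → ℝ := fun a => p a / (q a + s * p a) with hy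
  have hp0 : ∀ a, 0 ≤ p a := fun a => by positivity
  have hq0 : ∀ a, 0 ≤ q a := fun a => by positivity
  have ht : ∀ i, t i = ‖g i‖ ^ 2 := eq_norm_sq_of_inner_eq_ite hg
  have hr : ∀ j, r j = ‖h j‖ ^ 2 := eq_norm_sq_of_inner_eq_ite hh
  -- the diagonal operator at which the variational expression is evaluated
  let Y : PiLp 2 (fun _ : A => H) → PiLp 2 (fun _ : A => H) :=
    fun x => WithLp.toLp 2 fun a => (y a : ℂ) • x a
  have hYapp : ∀ x a, Y x a = (y a : ℂ) • x a := fun x a => rfl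
  have hYnorm : ∀ x, ‖Y x‖ ^ 2 = ∑ a, y a ^ 2 * ‖x a‖ ^ 2 := fun x => by
    rw [PiLp.norm_sq_eq_of_L2]
    refine Finset.sum_congr rfl fun a _ => ?_
    rw [hYapp, norm_smul, mul_pow, Complex.norm_real, Real.norm_eq_abs, sq_abs]
  have hYsymm : ∀ x z, inner ℂ (Y x) z = inner ℂ x (Y z) := fun x z => by
    simp only [PiLp.inner_apply, hYapp, inner_smul_left, inner_smul_right, Complex.conj_ofReal]
  have hYsum : ∀ i, Y (g i) = ∑ j, v j i • Y (h j) := fun i => by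
    ext a
    simp only [hv i, hYapp, WithLp.ofLp_sum, Finset.sum_apply, WithLp.ofLp_smul, Pi.smul_apply,
      Finset.smul_sum]
    exact Finset.sum_congr rfl fun j _ => smul_comm _ _ _
  have hYself : ∀ x, (inner ℂ x (Y x)).re = ∑ a, y a * ‖x a‖ ^ 2 := fun x => by
    rw [PiLp.inner_apply, Complex.re_sum]
    refine Finset.sum_congr rfl fun a _ => ?_
    rw [hYapp, inner_smul_right, inner_self_eq_norm_sq_to_K, Complex.re_ofReal_mul]
    norm_cast
  have e1 : ∑ a, y a * p a = ∑ i, ∑ j, (v j i * inner ℂ (g i) (Y (h j))).re := by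
    simp only [hp, Finset.mul_sum]
    rw [Finset.sum_comm]
    refine Finset.sum_congr rfl fun i _ => ?_
    rw [← hYself, hYsum, inner_sum, Complex.re_sum]
    simp only [inner_smul_right]
  have e2 : ∑ i, ∑ j, (t i)⁻¹ * ‖inner ℂ (g i) (Y (h j))‖ ^ 2 ≤ ∑ a, y a ^ 2 * q a := by
    rw [Finset.sum_comm]
    refine (Finset.sum_le_sum fun j _ => sum_inv_mul_norm_inner_sq_le g t hg (Y (h j))).trans ?_
    simp only [hYnorm, hq, Finset.mul_sum]
    rw [Finset.sum_comm]
  have e3 : ∑ i, ∑ j, (r j)⁻¹ * ‖inner ℂ (g i) (Y (h j))‖ ^ 2 ≤ ∑ a, y a ^ 2 * p a := by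
    have h1 : ∀ i j, ‖inner ℂ (g i) (Y (h j))‖ = ‖inner ℂ (h j) (Y (g i))‖ := fun i j => by
      rw [← hYsymm, norm_inner_symm]
    simp only [h1]
    refine (Finset.sum_le_sum fun i _ => sum_inv_mul_norm_inner_sq_le h r hh (Y (g i))).trans ?_
    simp only [hYnorm, hp, Finset.mul_sum]
    rw [Finset.sum_comm]
  have e4 : 2 * ∑ a, y a * p a ≤ ∑ i, ∑ j, (t i)⁻¹ * ‖inner ℂ (g i) (Y (h j))‖ ^ 2
      + s * (∑ i, ∑ j, (r j)⁻¹ * ‖inner ℂ (g i) (Y (h j))‖ ^ 2)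
      + ∑ i, ∑ j, ‖v j i‖ ^ 2 * r j * (t i / (r j + s * t i)) := by
    rw [e1]
    simp only [Finset.mul_sum, ← Finset.sum_add_distrib]
    refine Finset.sum_le_sum fun i _ => Finset.sum_le_sum fun j _ => ?_
    refine two_mul_re_mul_le (by rw [hr]; positivity) (by rw [ht]; positivity) hs ?_ ?_
    · intro h0
      have : h j = 0 := by simpa [hr] using h0
      rw [← hYsymm, this, inner_zero_right]
    · intro h0
      have : g i = 0 := by simpa [ht] using h0
      rw [this, inner_zero_left]
  have e5 : ∑ a, y a ^ 2 * q a + s * ∑ a, y a ^ 2 * p a = ∑ a, y a * p a := by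
    rw [Finset.mul_sum, ← Finset.sum_add_distrib]
    refine Finset.sum_congr rfl fun a _ => ?_
    by_cases hpa : p a = 0
    · simp [hy, hpa]
    · have h1 : 0 < p a := lt_of_le_of_ne (hp0 a) (Ne.symm hpa)
      have h2 := hq0 a
      have h3 : q a + s * p a ≠ 0 := by positivity
      simp only [hy]
      field_simp
  have e6 : ∑ a, p a * (p a / (q a + s * p a)) = ∑ a, y a * p a :=
    Finset.sum_congr rfl fun a _ => mul_comm _ _
  have e7 := mul_le_mul_of_nonneg_left e3 hs.le
  rw [e6]
  linarith

/-- Monotonicity of relative entropy under the measurement of the coordinate `a`, for the operators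
`∑ i, |g i⟩⟨g i|` and `∑ j, |h j⟩⟨h j|`. -/
theorem sum_mul_log_le
    (g : I → PiLp 2 (fun _ : A => H)) (h : J → PiLp 2 (fun _ : A => H))
    (t : I → ℝ) (r : J → ℝ) (v : J → I → ℂ)
    (hg : ∀ i k, inner ℂ (g i) (g k) = if i = k then (t i : ℂ) else 0)
    (hh : ∀ j l, inner ℂ (h j) (h l) = if j = l then (r j : ℂ) else 0)
    (hv : ∀ i, g i = ∑ j, v j i • h j) :
    ∑ a, (∑ i, ‖g i a‖ ^ 2) *
        (Real.log (∑ i, ‖g i a‖ ^ 2) - Real.log (∑ j, ‖h j a‖ ^ 2)) ≤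
      ∑ i, t i * Real.log (t i) - ∑ j, r j * Real.log (r j) * ∑ i, ‖v j i‖ ^ 2 := by
  set p : A → ℝ := fun a => ∑ i, ‖g i a‖ ^ 2 with hp
  set q : A → ℝ := fun a => ∑ j, ‖h j a‖ ^ 2 with hq
  have hp0 : ∀ a, 0 ≤ p a := fun a => by positivity
  have hq0 : ∀ a, 0 ≤ q a := fun a => by positivity
  have ht : ∀ i, t i = ‖g i‖ ^ 2 := eq_norm_sq_of_inner_eq_ite hg
  have hr : ∀ j, r j = ‖h j‖ ^ 2 := eq_norm_sq_of_inner_eq_ite hh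
  have hr0 : ∀ j, 0 ≤ r j := fun j => by rw [hr]; positivity
  have hsum : ∀ i, ∑ j, ‖v j i‖ ^ 2 * r j = t i := fun i => by
    have h1 := hg i i
    rw [if_pos rfl, hv i] at h1
    simp only [sum_inner, inner_sum, inner_smul_left, inner_smul_right, hh, mul_ite, mul_zero,
      Finset.sum_ite_eq', Finset.mem_univ, if_true] at h1
    have h2 : ((∑ j, ‖v j i‖ ^ 2 * r j : ℝ) : ℂ) = (t i : ℂ) := by
      rw [← h1]
      push_cast
      refine Finset.sum_congr rfl fun j _ => ?_
      rw [← mul_assoc, Complex.mul_conj']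
    exact_mod_cast h2
  have htpos : ∀ i j, ‖v j i‖ ^ 2 * r j ≠ 0 → 0 < t i := fun i j hij => by
    rw [← hsum i]
    have h0 : ∀ l, 0 ≤ ‖v l i‖ ^ 2 * r l := fun l => mul_nonneg (by positivity) (hr0 l)
    exact lt_of_lt_of_le (lt_of_le_of_ne (h0 j) (Ne.symm hij))
      (Finset.single_le_sum (fun l _ => h0 l) (Finset.mem_univ j))
  -- `q a = 0` forces all `h j a`, hence all `g i a`, to vanish
  have hqpos : ∀ a, p a ≠ 0 → 0 < q a := fun a ha => by
    refine lt_of_le_of_ne (hq0 a) fun h0 => ha ?_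
    have h1 : ∀ j, h j a = 0 := fun j => by
      have := (Finset.sum_eq_zero_iff_of_nonneg (fun j _ => by positivity)).1 h0.symm j
        (Finset.mem_univ j)
      simpa using this
    simp [hp, hv, h1]
  have htot : ∑ i, t i = ∑ a, p a := by
    simp only [ht, PiLp.norm_sq_eq_of_L2, hp]
    rw [Finset.sum_comm]
  -- the difference of the two sides is a single sum, of signed weights of total zero
  have key := sum_mul_log_sub_log_nonneg (κ := (I × J) ⊕ A)
    (Sum.elim (fun x => ‖v x.2 x.1‖ ^ 2 * r x.2) (fun a => - p a))
    (Sum.elim (fun x => r x.2) q) (Sum.elim (fun x => t x.1) p)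
    (by
      rintro (⟨i, j⟩ | a) hk
      · exact lt_of_le_of_ne (hr0 j) fun h0 => hk (mul_eq_zero_of_right _ h0.symm)
      · exact hqpos a (by simpa using hk))
    (by
      rintro (⟨i, j⟩ | a) hk
      · exact htpos i j hk
      · exact lt_of_le_of_ne (hp0 a) (Ne.symm (by simpa using hk)))
    (by
      simp only [Fintype.sum_sum_type, Sum.elim_inl, Sum.elim_inr, Fintype.sum_prod_type, hsum,
        Finset.sum_neg_distrib, htot, add_neg_cancel])
    (by
      intro s hs
      have := sum_sq_div_le g h t r v hg hh hv hs
      simp only [Fintype.sum_sum_type, Sum.elim_inl, Sum.elim_inr, Fintype.sum_prod_type,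
        Finset.sum_neg_distrib, neg_mul]
      linarith)
  simp only [Fintype.sum_sum_type, Sum.elim_inl, Sum.elim_inr, Fintype.sum_prod_type,
    Finset.sum_neg_distrib, neg_mul] at key
  have e1 : ∑ i, ∑ j, ‖v j i‖ ^ 2 * r j * (Real.log (t i) - Real.log (r j)) =
      ∑ i, t i * Real.log (t i) - ∑ j, r j * Real.log (r j) * ∑ i, ‖v j i‖ ^ 2 := by
    simp only [mul_sub, Finset.sum_sub_distrib, ← Finset.sum_mul, hsum]
    congr 1
    rw [Finset.sum_comm]
    refine Finset.sum_congr rfl fun j _ => ?_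
    rw [Finset.mul_sum]
    exact Finset.sum_congr rfl fun i _ => by ring
  linarith

/-! ### Traces and probabilities -/

section Trace

variable {H : Type*} [NormedAddCommGroup H] [InnerProductSpace ℂ H]

theorem trace_eq_sum_inner {I : Type*} [Fintype I] (T : H →L[ℂ] H) (u : OrthonormalBasis I ℂ H) :
    trace T = ∑ i, inner ℂ (u i) (T (u i)) :=
  LinearMap.trace_eq_sum_inner _ u

theorem trace_mul_comm (S T : H →L[ℂ] H) : trace (S * T) = trace (T * S) :=
  LinearMap.trace_mul_comm ℂ (S : H →ₗ[ℂ] H) (T : H →ₗ[ℂ] H)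

theorem prob_sum_right {A : Type*} [Fintype A] (F : H →L[ℂ] H) (τ : A → H →L[ℂ] H) :
    prob F (∑ a, τ a) = ∑ a, prob F (τ a) := by
  simp [prob, trace, Finset.mul_sum]

theorem prob_sum_left {B : Type*} [Fintype B] (E : B → H →L[ℂ] H) (τ : H →L[ℂ] H) :
    prob (∑ b, E b) τ = ∑ b, prob (E b) τ := by
  simp [prob, trace, Finset.sum_mul]

theorem prob_smul [FiniteDimensional ℂ H] (F τ : H →L[ℂ] H) (c : ℝ) :
    prob F (c • τ) = c * prob F τ := by
  have u := stdOrthonormalBasis ℂ H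
  simp only [prob, trace_eq_sum_inner _ u, Complex.re_sum, Finset.mul_sum]
  refine Finset.sum_congr rfl fun i _ => ?_
  simp [← Complex.coe_smul]

end Trace

/-! ### Square roots of positive operators -/

section Sqrt

variable {H : Type*} [NormedAddCommGroup H] [InnerProductSpace ℂ H] [CompleteSpace H]

theorem isSelfAdjoint_sqrt (T : H →L[ℂ] H) : IsSelfAdjoint (CFC.sqrt T) :=
  (CFC.sqrt_nonneg T).isSelfAdjoint

theorem inner_sqrt_apply_comm (T : H →L[ℂ] H) (x y : H) :
    inner ℂ (CFC.sqrt T x) y = inner ℂ x (CFC.sqrt T y) :=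
  (isSelfAdjoint_sqrt T).isSymmetric x y

theorem sqrt_apply_sqrt_apply {T : H →L[ℂ] H} (hT : T.IsPositive) (x : H) :
    CFC.sqrt T (CFC.sqrt T x) = T x := by
  have h := CFC.sqrt_mul_sqrt_self T ((ContinuousLinearMap.nonneg_iff_isPositive T).2 hT)
  exact congrArg (fun S : H →L[ℂ] H => S x) h

theorem inner_sqrt_apply_sqrt_apply {T : H →L[ℂ] H} (hT : T.IsPositive) (x y : H) :
    inner ℂ (CFC.sqrt T x) (CFC.sqrt T y) = inner ℂ x (T y) := by
  rw [inner_sqrt_apply_comm, sqrt_apply_sqrt_apply hT]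

theorem inner_apply_self_re {T : H →L[ℂ] H} (hT : T.IsPositive) (x : H) :
    (inner ℂ x (T x)).re = ‖CFC.sqrt T x‖ ^ 2 := by
  rw [← inner_sqrt_apply_sqrt_apply hT, inner_self_eq_norm_sq_to_K]
  norm_cast

theorem isSelfAdjoint_sqrt_mul_mul_sqrt (F : H →L[ℂ] H) {T : H →L[ℂ] H} (hT : IsSelfAdjoint T) :
    IsSelfAdjoint (CFC.sqrt F * T * CFC.sqrt F) := by
  have h := hT.conjugate (CFC.sqrt F)
  rwa [(isSelfAdjoint_sqrt F).star_eq] at h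

theorem trace_mul_eq_trace_sqrt_mul_mul_sqrt {F : H →L[ℂ] H} (hF : F.IsPositive)
    (T : H →L[ℂ] H) : trace (F * T) = trace (CFC.sqrt F * T * CFC.sqrt F) := by
  rw [trace_mul_comm (CFC.sqrt F * T), ← mul_assoc,
    CFC.sqrt_mul_sqrt_self F ((ContinuousLinearMap.nonneg_iff_isPositive F).2 hF)]

theorem prob_eq_sum_norm_sq {I : Type*} [Fintype I] {F τ : H →L[ℂ] H} (hF : F.IsPositive)
    (hτ : τ.IsPositive) (u : OrthonormalBasis I ℂ H) :
    prob F τ = ∑ i, ‖CFC.sqrt τ (CFC.sqrt F (u i))‖ ^ 2 := by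
  rw [prob, trace_mul_eq_trace_sqrt_mul_mul_sqrt hF, trace_eq_sum_inner _ u, Complex.re_sum]
  refine Finset.sum_congr rfl fun i _ => ?_
  rw [← inner_apply_self_re hτ, inner_sqrt_apply_comm]
  rfl

end Sqrt

/-! ### Functional calculus and entropy in an eigenbasis -/

section Operators

variable {H : Type*} [NormedAddCommGroup H] [InnerProductSpace ℂ H] [FiniteDimensional ℂ H]
  [CompleteSpace H] {I : Type*} [Fintype I]

theorem finite_real_spectrum (T : H →L[ℂ] H) : (spectrum ℝ T).Finite := by
  rw [← spectrum.preimage_algebraMap ℂ]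
  refine Set.Finite.preimage (FaithfulSMul.algebraMap_injective ℝ ℂ).injOn ?_
  rw [ContinuousLinearMap.spectrum_eq]
  exact Module.End.finite_spectrum _

theorem cfc_apply_of_apply_eq_smul {T : H →L[ℂ] H} (hT : IsSelfAdjoint T) (f : ℝ → ℝ) {u : H}
    {t : ℝ} (hu : T u = (t : ℂ) • u) : cfc f T u = (f t : ℂ) • u := by
  classical
  -- on the finite set of nodes, `f` agrees with its interpolation polynomial
  set s : Finset ℝ := insert t (finite_real_spectrum T).toFinset with hs
  set P : Polynomial ℝ := Lagrange.interpolate s id f with hP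
  have hPf : ∀ x ∈ s, P.eval x = f x := fun x hx =>
    Lagrange.eval_interpolate_at_node (v := id) f Function.injective_id.injOn hx
  have h1 : cfc f T = Polynomial.aeval T P := by
    rw [← cfc_polynomial P T hT]
    refine cfc_congr fun x hx => (hPf x ?_).symm
    exact Finset.mem_insert_of_mem ((finite_real_spectrum T).mem_toFinset.2 hx)
  have h2 : ∀ Q : Polynomial ℝ, Polynomial.aeval T Q u = ((Q.eval t : ℝ) : ℂ) • u := by
    intro Q
    induction Q using Polynomial.induction_on with
    | C a => simp [Algebra.algebraMap_eq_smul_one]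
    | add p q hp hq => simp [hp, hq, add_smul]
    | monomial n a ih =>
      rw [pow_succ, ← mul_assoc, map_mul, Polynomial.aeval_X, mul_apply_eq_comp, hu,
        map_smul, ih, smul_smul, Polynomial.eval_mul_X, Complex.ofReal_mul, mul_comm]
  rw [h1, h2, hPf t (Finset.mem_insert_self _ _)]

theorem entropy_eq_neg_sum {T : H →L[ℂ] H} (hT : IsSelfAdjoint T) (u : OrthonormalBasis I ℂ H)
    (t : I → ℝ) (hu : ∀ i, T (u i) = (t i : ℂ) • u i) :
    entropy T = -∑ i, t i * Real.log (t i) := by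
  rw [entropy, trace_eq_sum_inner _ u, Complex.re_sum]
  congr 1
  refine Finset.sum_congr rfl fun i _ => ?_
  rw [mul_apply_eq_comp, CFC.log, cfc_apply_of_apply_eq_smul hT Real.log (hu i),
    map_smul, hu i, inner_smul_right, inner_smul_right, inner_self_eq_norm_sq_to_K,
    u.norm_eq_one]
  simp [mul_comm]

theorem exists_eigenbasis {T : H →L[ℂ] H} (hT : IsSelfAdjoint T) :
    ∃ (u : OrthonormalBasis (Fin (Module.finrank ℂ H)) ℂ H) (t : Fin (Module.finrank ℂ H) → ℝ),
      ∀ i, T (u i) = (t i : ℂ) • u i :=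
  ⟨hT.isSymmetric.eigenvectorBasis rfl, hT.isSymmetric.eigenvalues rfl,
    hT.isSymmetric.apply_eigenvectorBasis rfl⟩

theorem prob_nonneg {F τ : H →L[ℂ] H} (hF : F.IsPositive) (hτ : τ.IsPositive) : 0 ≤ prob F τ := by
  rw [prob_eq_sum_norm_sq hF hτ (stdOrthonormalBasis ℂ H)]
  positivity

/-- The entropy of the state after an outcome, in terms of the eigenvalues of the unnormalized state
`√F ρ √F`. The identity includes the case of an outcome of probability zero, in which all the
eigenvalues vanish. -/
theorem prob_mul_entropy_postState {F ρ : H →L[ℂ] H} (hF : F.IsPositive) (hρ : ρ.IsPositive)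
    (u : OrthonormalBasis I ℂ H) (t : I → ℝ)
    (hu : ∀ i, (CFC.sqrt F * ρ * CFC.sqrt F) (u i) = (t i : ℂ) • u i) :
    prob F ρ * entropy (postState F ρ) =
      prob F ρ * Real.log (prob F ρ) - ∑ i, t i * Real.log (t i) := by
  have ht : ∀ i, t i = ‖CFC.sqrt ρ (CFC.sqrt F (u i))‖ ^ 2 := fun i => by
    have h1 : CFC.sqrt F (ρ (CFC.sqrt F (u i))) = (t i : ℂ) • u i := hu i
    rw [← inner_apply_self_re hρ, inner_sqrt_apply_comm, h1, inner_smul_right,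
      inner_self_eq_norm_sq_to_K, u.norm_eq_one]
    simp
  have hsum : ∑ i, t i = prob F ρ := by
    rw [prob_eq_sum_norm_sq hF hρ u]
    exact Finset.sum_congr rfl fun i _ => ht i
  have hent : entropy (postState F ρ) =
      -∑ i, ((prob F ρ)⁻¹ * t i) * Real.log ((prob F ρ)⁻¹ * t i) := by
    refine entropy_eq_neg_sum ?_ u _ fun i => ?_
    · exact IsSelfAdjoint.smul (.all _) (isSelfAdjoint_sqrt_mul_mul_sqrt F hρ.isSelfAdjoint)
    · rw [postState, smul_apply, hu, Complex.ofReal_mul, mul_smul,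
        Complex.coe_smul _ (((t i : ℝ) : ℂ) • u i)]
  by_cases hP : prob F ρ = 0
  · have h0 : ∀ i, t i = 0 := fun i => by
      rw [hP] at hsum
      exact (Finset.sum_eq_zero_iff_of_nonneg (fun k _ => by rw [ht k]; positivity)).1 hsum i
        (Finset.mem_univ i)
    simp [hP, h0]
  · have h1 : ∀ i, prob F ρ * (((prob F ρ)⁻¹ * t i) * Real.log ((prob F ρ)⁻¹ * t i)) =
        t i * Real.log (t i) - t i * Real.log (prob F ρ) := fun i => by
      by_cases hi : t i = 0
      · simp [hi]
      · rw [Real.log_mul (inv_ne_zero hP) hi, Real.log_inv]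
        field_simp
        ring
    rw [hent, mul_neg, Finset.mul_sum]
    simp only [h1, Finset.sum_sub_distrib, ← Finset.sum_mul, hsum]
    ring

end Operators

/-! ### The inequality for a single outcome -/

section SingleOutcome

variable {H : Type*} [NormedAddCommGroup H] [InnerProductSpace ℂ H] [CompleteSpace H]
  {A I J : Type*} [Fintype A] [Fintype I] [DecidableEq I] [Fintype J] [DecidableEq J]

/-- The inequality for a single outcome `F` of the measurement and an ensemble `τ` of unnormalized
states: in basis-free form, `∑ p_a (ln p_a - ln q_a) ≤ tr[X ln X] - tr[F ρ ln ρ]` with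
`X = √F ρ √F`, `p_a = tr[F τ_a]` and `q_a = tr τ_a`. -/
theorem sum_prob_mul_log_le {F ρ : H →L[ℂ] H} (hF : F.IsPositive) {τ : A → H →L[ℂ] H}
    (hτ : ∀ a, (τ a).IsPositive) (hρ : ρ = ∑ a, τ a)
    (u : OrthonormalBasis I ℂ H) (t : I → ℝ)
    (hu : ∀ i, (CFC.sqrt F * ρ * CFC.sqrt F) (u i) = (t i : ℂ) • u i)
    (e : OrthonormalBasis J ℂ H) (r : J → ℝ) (he : ∀ j, ρ (e j) = (r j : ℂ) • e j) :
    ∑ a, prob F (τ a) * (Real.log (prob F (τ a)) - Real.log (trace (τ a)).re) ≤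
      ∑ i, t i * Real.log (t i) -
        ∑ j, r j * Real.log (r j) * (inner ℂ (e j) (F (e j))).re := by
  -- `m⋆ m = ρ`, and the coordinate `a` of the Hilbert sum carries `τ a`
  let m : H → PiLp 2 (fun _ : A => H) := fun x => WithLp.toLp 2 fun a => CFC.sqrt (τ a) x
  have hm : ∀ x z, inner ℂ (m x) (m z) = inner ℂ x (ρ z) := fun x z => by
    simp only [m, PiLp.inner_apply, inner_sqrt_apply_sqrt_apply (hτ _), hρ,
      sum_apply, inner_sum]
  have key := sum_mul_log_le (fun i => m (CFC.sqrt F (u i))) (fun j => m (e j)) t r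
    (fun j i => inner ℂ (e j) (CFC.sqrt F (u i)))
    (by
      intro i k
      rw [hm, inner_sqrt_apply_comm]
      have h1 : CFC.sqrt F (ρ (CFC.sqrt F (u k))) = (t k : ℂ) • u k := hu k
      rw [h1, inner_smul_right, u.inner_eq_ite]
      split_ifs with h
      · rw [h, mul_one]
      · rw [mul_zero])
    (by
      intro j l
      rw [hm, he, inner_smul_right, e.inner_eq_ite]
      split_ifs with h
      · rw [h, mul_one]
      · rw [mul_zero])
    (by
      intro i
      ext a
      simp only [m, WithLp.ofLp_sum, Finset.sum_apply, WithLp.ofLp_smul, Pi.smul_apply,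
        ← map_smul, ← map_sum, e.sum_repr'])
  have h1 : ∀ a, ∑ i, ‖(m (CFC.sqrt F (u i))) a‖ ^ 2 = prob F (τ a) := fun a =>
    (prob_eq_sum_norm_sq hF (hτ a) u).symm
  have h2 : ∀ a, ∑ j, ‖(m (e j)) a‖ ^ 2 = (trace (τ a)).re := fun a => by
    rw [trace_eq_sum_inner _ e, Complex.re_sum]
    exact Finset.sum_congr rfl fun j _ => (inner_apply_self_re (hτ a) (e j)).symm
  have h3 : ∀ j, ∑ i, ‖inner ℂ (e j) (CFC.sqrt F (u i))‖ ^ 2 =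
      (inner ℂ (e j) (F (e j))).re := fun j => by
    rw [inner_apply_self_re hF, ← u.sum_sq_norm_inner_left]
    exact Finset.sum_congr rfl fun i _ => by rw [inner_sqrt_apply_comm]
  simpa only [h1, h2, h3] using key

end SingleOutcome

/-- Holds also for `p = 0`, where both sides vanish. -/
theorem mul_log_div_mul {p q P : ℝ} (hq : p ≠ 0 → q ≠ 0) (hP : p ≠ 0 → P ≠ 0) :
    p * Real.log (p / (q * P)) = p * (Real.log p - Real.log q) - p * Real.log P := by
  by_cases hp : p = 0
  · simp [hp]
  · rw [Real.log_div hp (mul_ne_zero (hq hp) (hP hp)), Real.log_mul (hq hp) (hP hp)]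
    ring

end QuantumInfo

/-! ### The dual of the Holevo bound -/

open QuantumInfo in
theorem theorem4p7 {H : Type*} [NormedAddCommGroup H] [InnerProductSpace ℂ H]
    [FiniteDimensional ℂ H] [CompleteSpace H]
    {A B : Type*} [Fintype A] [Fintype B]
    (E : B → H →L[ℂ] H) (hE : QuantumInfo.IsPOVM E)
    (ρ : H →L[ℂ] H) (hρ : QuantumInfo.IsDensityOperator ρ)
    (q : A → ℝ) (hq_nonneg : ∀ a, 0 ≤ q a) (hq_sum : ∑ a, q a = 1)
    (σ : A → H →L[ℂ] H) (hσ : ∀ a, QuantumInfo.IsDensityOperator (σ a))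
    (hdecomp : ρ = ∑ a, q a • σ a) :
    QuantumInfo.classicalMutualInfo (fun a b => QuantumInfo.prob (E b) (σ a) * q a) ≤
      QuantumInfo.qcMutualInfo E ρ := by
  have hτ : ∀ a, (q a • σ a).IsPositive := fun a => by
    rw [← ContinuousLinearMap.nonneg_iff_isPositive]
    exact smul_nonneg (hq_nonneg a)
      ((ContinuousLinearMap.nonneg_iff_isPositive _).2 (hσ a).isPositive)
  have hp : ∀ a b, prob (E b) (q a • σ a) = prob (E b) (σ a) * q a := fun a b => by
    rw [prob_smul, mul_comm]
  have hq : ∀ a, (trace (q a • σ a)).re = q a := fun a => by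
    have h := prob_smul 1 (σ a) (q a)
    simpa [prob, (hσ a).trace_eq_one] using h
  have hp0 : ∀ a b, 0 ≤ prob (E b) (σ a) * q a := fun a b =>
    mul_nonneg (prob_nonneg (hE.isPositive b) (hσ a).isPositive) (hq_nonneg a)
  have hmargA : ∀ a, ∑ b, prob (E b) (σ a) * q a = q a := fun a => by
    rw [← Finset.sum_mul, ← prob_sum_left, hE.sum_eq_one, prob, one_mul, (hσ a).trace_eq_one,
      Complex.one_re, one_mul]
  have hmargB : ∀ b, ∑ a, prob (E b) (σ a) * q a = prob (E b) ρ := fun b => by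
    simp only [hdecomp, prob_sum_right, hp]
  obtain ⟨e, r, he⟩ := exists_eigenbasis hρ.isPositive.isSelfAdjoint
  have hX : ∀ b, IsSelfAdjoint (CFC.sqrt (E b) * ρ * CFC.sqrt (E b)) := fun b =>
    isSelfAdjoint_sqrt_mul_mul_sqrt (E b) hρ.isPositive.isSelfAdjoint
  choose u t hu using fun b => exists_eigenbasis (hX b)
  have hI : classicalMutualInfo (fun a b => prob (E b) (σ a) * q a) =
      ∑ b, (∑ a, prob (E b) (q a • σ a) *
          (Real.log (prob (E b) (q a • σ a)) - Real.log (trace (q a • σ a)).re) -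
        prob (E b) ρ * Real.log (prob (E b) ρ)) := by
    rw [classicalMutualInfo, Finset.sum_comm]
    refine Finset.sum_congr rfl fun b _ => ?_
    simp only [hmargA, hmargB, hp, hq]
    nth_rewrite 2 [← hmargB b]
    rw [Finset.sum_mul, ← Finset.sum_sub_distrib]
    refine Finset.sum_congr rfl fun a _ => mul_log_div_mul (right_ne_zero_of_mul) fun h => ?_
    rw [← hmargB b]
    exact ((lt_of_le_of_ne (hp0 a b) (Ne.symm h)).trans_le
      (Finset.single_le_sum (fun a' _ => hp0 a' b) (Finset.mem_univ a))).ne'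
  have hQ : qcMutualInfo E ρ =
      ∑ b, (∑ i, t b i * Real.log (t b i) -
        ∑ j, r j * Real.log (r j) * (inner ℂ (e j) (E b (e j))).re -
        prob (E b) ρ * Real.log (prob (E b) ρ)) := by
    have h1 : ∑ b, ∑ j, r j * Real.log (r j) * (inner ℂ (e j) (E b (e j))).re =
        ∑ j, r j * Real.log (r j) := by
      rw [Finset.sum_comm]
      refine Finset.sum_congr rfl fun j _ => ?_
      rw [← Finset.mul_sum, ← Complex.re_sum, ← inner_sum, ← sum_apply,
        hE.sum_eq_one]
      simp [inner_self_eq_norm_sq_to_K]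
    rw [qcMutualInfo, entropy_eq_neg_sum hρ.isPositive.isSelfAdjoint e r he]
    simp only [fun b => prob_mul_entropy_postState (hE.isPositive b) hρ.isPositive (u b) (t b)
      (hu b), Finset.sum_sub_distrib, h1]
    ring
  rw [hI, hQ]
  refine Finset.sum_le_sum fun b _ => sub_le_sub_right ?_ _
  exact sum_prob_mul_log_le (hE.isPositive b) hτ hdecomp (u b) (t b) (hu b) e r he
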